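/- Let $K$ be a field with algebraic closure $\overline K$, and let $v$ be a valuation on $\overline K$, written additively, such that $(K,v)$ is henselian, i.e. $v$ is up to equivalence the only extension of $v|_K$ to $\overline K$. For a finite extension $L|K$ in $\overline K$ let $vL$, $Lv$ and $\mathcal O_L$ be its value group, residue field and valuation ring, and let $d(L|K,v):=[L:K]/\big((vL:vK)[Lv:Kv]\big)$ be its defect. For $z\in\overline K$ let $\deg_K(z):=[K(z):K]$. For $a\in\overline K$ and $d\geq 1$ put $D_d:=\{v(z-a)\mid z\in\overline K,\ \deg_K(z)=d\}$. An Okutsu sequence of length $n$ of $a$ over $K$ is a sequence $A_0=\{a\},A_1,\dots,A_n$ of non-empty subsets of $\overline K$ such that all elements of $A_i$ have the same degree $d_i$ over $K$, $\deg_K(a)=d_0>d_1>\dots>d_n=1$, and for $1\le i\le n$: (1) for each $z\in\overline K$ with $\deg_K(z)<d_{i-1}$ there is $z_i\in A_i$ with $v(a-z_i)\geq v(a-z)$; (2) $v(a-z_{i-1})>v(a-z_i)$ for all $z_{i-1}\in A_{i-1}$, $z_i\in A_i$; (3) $A_i$ is a singleton if and only if $\max D_{d_i}$ exists, and if $A_i=\{a_i\}$,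 then $v(a-a_i)=\max D_{d_i}=\max\{v(a-z)\mid \deg_K(z)<d_{i-1}\}$; (4) if $\max D_{d_i}$ does not exist, then $A_i=\{y_\nu\}_{\nu<\lambda_i}$ for a limit ordinal $\lambda_i$, where $v(a-y_\mu)>v(a-y_\nu)$ for $\nu<\mu<\lambda_i$. All Okutsu sequences of $a$ over $K$ have the same length, called the depth of $a$ over $K$, and $a$ is called pure over $K$ if its depth is $1$. A family $(z_\nu)_{\nu<\lambda}$ in $K$, with $\lambda$ a (non-zero) limit ordinal, is pseudo-convergent if $v(z_\nu-z_\mu)<v(z_\mu-z_\rho)$ for all $\nu<\mu<\rho<\lambda$; an element $x\in\overline K$ is a limit of it if $v(x-z_\nu)=v(z_\nu-z_{\nu+1})$ for all $\nu<\lambda$. For a finite Galois extension $\Omega|K$ in $\overline K$ and a subgroup $H$ of $\mathrm{Gal}(\Omega|K)$ let $\mathcal I_H$ be the ideal of $\mathcal O_\Omega$ generated by the elements $\frac{\sigma z}{z}-1$ with $\sigma\in H$ and $z\in\Omega^\times$ (these lie in $\mathcal O_\Omega$). **Theorem.** Let $a\in\overline K$ be pure over $K$, and suppose that $K(a)|K$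 is a Galois extension with $d(K(a)|K,v)>1$. Let $(z_\nu)_{\nu<\lambda}$ be a pseudo-convergent sequence in $K$ which has $a$ as a limit and has no limit in $K$. Then for every subgroup $H$ of $\mathrm{Gal}(K(a)|K)$, the elements $\frac{\sigma a-a}{a-z_\nu}$ with $\sigma\in H$ and $\nu<\lambda$ lie in $\mathcal O_{K(a)}$, and $$\mathcal I_H=\left(\frac{\sigma a-a}{a-z_\nu}\ \Big|\ \sigma\in H,\ \nu<\lambda\right).$$ -/

import Mathlib

open scoped IntermediateField

universe u w

noncomputable section

namespace Purity

/-! Valuations are written multiplicatively, as in Mathlib: the order on values is the reverse of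
the order of the additive notation, so "`v x ≥ v y`" in additive notation is `v x ≤ v y` here, and
a maximum of additive values is a least element here. The field `Kbar` is an algebraic closure of
`K`, with a valuation `v`; every subextension of `Kbar | K` carries the restriction of `v`. -/

section Valued

variable {K Kbar : Type u} [Field K] [Field Kbar] [Algebra K Kbar]
  {Γ₀ : Type w} [LinearOrderedCommGroupWithZero Γ₀] (v : Valuation Kbar Γ₀)

variable (K) in
/-- `(K, v)` is henselian: `v` is, up to equivalence of valuations, the only extension to the
algebraic closure `Kbar` of its restriction to `K`. Valuations are compared through their
valuation rings, so that value groups in all universes are covered. -/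
def IsHenselian : Prop :=
  ∀ A : ValuationSubring Kbar,
    A.comap (algebraMap K Kbar) = v.valuationSubring.comap (algebraMap K Kbar) →
      A = v.valuationSubring

/-! ### The defect -/

/-- The value group `vL` of a subextension `L` of `Kbar | K`. -/
def valueGroup (L : IntermediateField K Kbar) : Subgroup Γ₀ˣ :=
  (Units.map (v.comap (algebraMap L Kbar) : L →* Γ₀)).range

/-- The residue field `Lv` of a subextension `L` of `Kbar | K`, inside the residue field of
`(Kbar, v)`: the set of residues of the elements of `L` that are integral for `v`. -/
def residueField (L : IntermediateField K Kbar) :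
    Subfield (IsLocalRing.ResidueField v.valuationSubring) where
  toSubring := (L.toSubring.comap v.valuationSubring.subtype).map
    (IsLocalRing.residue v.valuationSubring)
  inv_mem' := by
    rintro _ ⟨x, hx, rfl⟩
    by_cases h : IsUnit x
    · obtain ⟨y, rfl⟩ := h
      refine ⟨((y⁻¹ : (v.valuationSubring)ˣ) : v.valuationSubring), ?_, ?_⟩
      · have h1 : v.valuationSubring.subtype ((y⁻¹ : (v.valuationSubring)ˣ) : v.valuationSubring)
            = (v.valuationSubring.subtype y)⁻¹ := by
          refine eq_inv_of_mul_eq_one_left ?_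
          rw [← map_mul, Units.inv_mul, map_one]
        change v.valuationSubring.subtype _ ∈ L.toSubring
        rw [h1]
        exact L.inv_mem hx
      · refine eq_inv_of_mul_eq_one_left ?_
        rw [← map_mul, Units.inv_mul, map_one]
    · have h0 : IsLocalRing.residue v.valuationSubring x = 0 := by
        rw [IsLocalRing.residue_eq_zero_iff]
        exact h
      rw [h0, inv_zero]
      exact Subring.zero_mem _

/-- The defect `d(L|K, v) = [L : K] / ((vL : vK) [Lv : Kv])` of a finite subextension `L | K`. -/
def defect (L : IntermediateField K Kbar) : ℚ :=
  (Module.finrank K L : ℚ) /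
    (((valueGroup v (⊥ : IntermediateField K Kbar)).relIndex (valueGroup v L) : ℚ) *
      (Subfield.relfinrank (residueField v (⊥ : IntermediateField K Kbar))
        (residueField v L) : ℚ))

/-! ### Okutsu sequences, depth and purity -/

variable (K) in
/-- The degree over `K` of an element of `Kbar`. -/
def deg (z : Kbar) : ℕ := (minpoly K z).natDegree

variable (K) in
/-- All elements of the non-empty set `A` have degree `d` over `K`. -/
def HasCommonDegree (A : Set Kbar) (d : ℕ) : Prop :=
  A.Nonempty ∧ ∀ z ∈ A, deg K z = d

variable (K) in
/-- The set `D_d(a, K)` of the values of `z - a`, where `z` runs over the elements of degree `d`. -/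
def distSet (a : Kbar) (d : ℕ) : Set Γ₀ :=
  {γ | ∃ z : Kbar, deg K z = d ∧ v (z - a) = γ}

variable (K) in
/-- `A 0, …, A n` is an Okutsu sequence of `a` over `K`, with common degrees `d 0, …, d n`.
The members of `A` and `d` with index larger than `n` play no role. -/
structure IsOkutsuSequence (a : Kbar) (n : ℕ) (A : ℕ → Set Kbar) (d : ℕ → ℕ) : Prop where
  zero : A 0 = {a}
  commonDegree : ∀ i ≤ n, HasCommonDegree K (A i) (d i)
  degree_lt : ∀ i < n, d (i + 1) < d i
  degree_last : d n = 1
  exists_closer : ∀ i < n, ∀ z : Kbar, deg K z < d i → ∃ y ∈ A (i + 1), v (a - y) ≤ v (a - z)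
  closer : ∀ i < n, ∀ y ∈ A (i + 1), ∀ x ∈ A i, v (a - x) < v (a - y)
  singleton_iff : ∀ i < n, (∃ b, A (i + 1) = {b}) ↔ ∃ γ, IsLeast (distSet K v a (d (i + 1))) γ
  singleton_eq : ∀ i < n, ∀ b, A (i + 1) = {b} →
    IsLeast (distSet K v a (d (i + 1))) (v (a - b)) ∧
      IsLeast {γ | ∃ z : Kbar, deg K z < d i ∧ v (a - z) = γ} (v (a - b))
  sequence : ∀ i < n, (¬ ∃ γ, IsLeast (distSet K v a (d (i + 1))) γ) →
    ∃ (l : Ordinal.{u}) (y : Ordinal.{u} → Kbar), Order.IsSuccLimit l ∧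
      A (i + 1) = y '' Set.Iio l ∧
      ∀ ν μ, ν < μ → μ < l → v (a - y μ) < v (a - y ν)

variable (K) in
/-- The depth of `a` over `K`: the length of the Okutsu sequences of `a` over `K`. (All of them
have the same length, which we take as the least one.) -/
def depth (a : Kbar) : ℕ :=
  sInf {n | ∃ A d, IsOkutsuSequence K v a n A d}

variable (K) in
/-- `a` is pure over `K`. -/
def IsPure (a : Kbar) : Prop := depth K v a = 1

/-! ### Pseudo-convergent sequences -/

/-- `(z ν)_{ν < l}` is a pseudo-convergent sequence in `K`. The values of `z` at ordinals outside
`l` play no role. -/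
def IsPseudoConvergent (l : Ordinal.{u}) (z : Ordinal.{u} → K) : Prop :=
  Order.IsSuccLimit l ∧ ∀ ν μ ρ, ν < μ → μ < ρ → ρ < l →
    v (algebraMap K Kbar (z μ - z ρ)) < v (algebraMap K Kbar (z ν - z μ))

/-- `x` is a limit of `(z ν)_{ν < l}`. -/
def IsPseudoLimit (l : Ordinal.{u}) (z : Ordinal.{u} → K) (x : Kbar) : Prop :=
  ∀ ν < l, v (x - algebraMap K Kbar (z ν)) = v (algebraMap K Kbar (z ν - z (Order.succ ν)))

/-! ### Ramification ideals -/

/-- The valuation ring `O_Ω` of a subextension `Ω` of `Kbar | K`. -/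
def valRing (Ω : IntermediateField K Kbar) : ValuationSubring Ω :=
  (v.comap (algebraMap Ω Kbar)).valuationSubring

/-- The ideal of `O_Ω` that is generated by a set `S` of elements of `Ω`; it is used for sets `S`
that are contained in `O_Ω`. -/
def idealGenBy (Ω : IntermediateField K Kbar) (S : Set Ω) : Ideal (valRing v Ω) :=
  Ideal.span {x | (x : Ω) ∈ S}

/-- The elements `σ z / z - 1` for `σ` in `H` and `z` in `Ω` non-zero. -/
def ramificationGens {Ω : IntermediateField K Kbar} (H : Subgroup (Ω ≃ₐ[K] Ω)) : Set Ω :=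
  {x | ∃ σ ∈ H, ∃ z : Ω, z ≠ 0 ∧ x = σ z / z - 1}

/-- The ideal `I_H` of `O_Ω`. -/
def ramificationIdeal {Ω : IntermediateField K Kbar} (H : Subgroup (Ω ≃ₐ[K] Ω)) :
    Ideal (valRing v Ω) :=
  idealGenBy v Ω (ramificationGens H)

/-- The elements `(σ a - a) / (a - z ν)` of `K(a)` for `σ` in `H` and `ν < l`. -/
def quotientGens {a : Kbar} (H : Subgroup (K⟮a⟯ ≃ₐ[K] K⟮a⟯)) (l : Ordinal.{u})
    (z : Ordinal.{u} → K) : Set K⟮a⟯ :=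
  {x | ∃ σ ∈ H, ∃ ν < l,
    x = (σ (IntermediateField.AdjoinSimple.gen K a) - IntermediateField.AdjoinSimple.gen K a) /
      (IntermediateField.AdjoinSimple.gen K a - algebraMap K K⟮a⟯ (z ν))}

end Valued

end Purity

end

/-! Taking `x = a - z ν` in `σ x / x - 1` gives exactly `(σ a - a) / (a - z ν)`, so one inclusion is
immediate, as is integrality once `v` is known to be `σ`-invariant (`IsHenselian.map_algEquiv`).
Conversely, any non-zero `x` in `K(a)` is `f(a)` with `deg f < deg a`, so the roots `b` of `f` have
degree less than `deg a`. Purity bounds their closeness to `a` by that of elements of `K`; as the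
sequence has no limit in `K`, some `z ν` is at least as close to `a` as every `b`
(`exists_forall_map_sub_le`). Each factor of `σ x / x = ∏ (1 + (σ a - a) / (a - b))` then differs
from `1` by at most `v (σ a - a) / v (a - z ν) ≤ 1`, hence so does the product. In a valuation ring
this bound on values is divisibility. -/

namespace Purity

open Polynomial IntermediateField

/-! ### Ultrametric perturbation of products -/

section Multiplicative

variable {F : Type*} [CommRing F] {Γ₀ : Type*} [LinearOrderedCommGroupWithZero Γ₀]
  (v : Valuation F Γ₀)

/-- If `a'` is at least as close to `a` as `c`, and no element of `s` is closer to `a` than `c`,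
then moving from `a` to `a'` changes the product of the `x - b`, for `b` in `s`, by a relative
error of at most `v (a' - a) / v (a - c)`. -/
theorem map_prod_sub_sub_prod_sub_mul_le {a a' c : F} (h : v (a' - a) ≤ v (a - c))
    (s : Multiset F) (hs : ∀ b ∈ s, v (a - c) ≤ v (a - b)) :
    v ((s.map (a' - ·)).prod - (s.map (a - ·)).prod) * v (a - c) ≤
      v (a' - a) * v (s.map (a - ·)).prod := by
  induction s using Multiset.induction_on with
  | empty => simp
  | cons b s ih =>
    have ih' := ih fun x hx => hs x (Multiset.mem_cons_of_mem hx)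
    have hb := hs b (Multiset.mem_cons_self b s)
    simp only [Multiset.map_cons, Multiset.prod_cons]
    set P := (s.map (a - ·)).prod
    set P' := (s.map (a' - ·)).prod
    have hab : v (a' - b) ≤ v (a - b) := by
      -- Peeling off one factor leaves two errors, estimated separately by the induction hypothesis
      -- and by `v (a - c) ≤ v (a - b)`.
      rw [show a' - b = (a' - a) + (a - b) by ring]
      exact v.map_add_le (h.trans hb) le_rfl
    rw [show (a' - b) * P' - (a - b) * P = (a' - b) * (P' - P) + (a' - a) * P by ring,
      ← map_mul, add_mul, map_mul]
    refine v.map_add_le ?_ ?_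
    · rw [map_mul, map_mul, mul_assoc, mul_left_comm (v (a' - a))]
      exact mul_le_mul' hab ih'
    · rw [map_mul, map_mul, mul_assoc, mul_comm (v P)]
      exact mul_le_mul' le_rfl (mul_le_mul' hb le_rfl)

end Multiplicative

variable {K Kbar : Type u} [Field K] [Field Kbar] [Algebra K Kbar]
  {Γ₀ : Type w} [LinearOrderedCommGroupWithZero Γ₀] {v : Valuation Kbar Γ₀}

/-! ### Henselian valuations and automorphisms -/

/-- The pullback of the valuation ring along `τ` lies over the same ring of `K`, so it is the same
ring. This gives invariance of the order on values, not yet of the values themselves. -/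
theorem IsHenselian.map_le_one_iff (hens : IsHenselian K v) (τ : Kbar ≃ₐ[K] Kbar) (x : Kbar) :
    v (τ x) ≤ 1 ↔ v x ≤ 1 := by
  have h := hens (v.valuationSubring.comap (τ : Kbar →+* Kbar)) (by
    ext y
    simp [ValuationSubring.mem_comap])
  have hx := SetLike.ext_iff.mp h x
  simpa [ValuationSubring.mem_comap] using hx

theorem IsHenselian.map_le_map_iff (hens : IsHenselian K v) (τ : Kbar ≃ₐ[K] Kbar) (x y : Kbar) :
    v (τ x) ≤ v (τ y) ↔ v x ≤ v y := by
  by_cases hy : y = 0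
  · simp [hy]
  · have hvy : 0 < v y := zero_lt_iff.mpr ((Valuation.ne_zero_iff v).mpr hy)
    have hvy' : 0 < v (τ y) :=
      zero_lt_iff.mpr ((Valuation.ne_zero_iff v).mpr ((map_ne_zero τ).mpr hy))
    have h := hens.map_le_one_iff τ (x / y)
    rwa [map_div₀, map_div₀, map_div₀, div_le_one₀ hvy', div_le_one₀ hvy] at h

/-- A henselian valuation is invariant under the automorphisms of a finite normal subextension. -/
theorem IsHenselian.map_algEquiv [Normal K Kbar] (hens : IsHenselian K v)
    {L : IntermediateField K Kbar} [FiniteDimensional K L] (σ : L ≃ₐ[K] L) (x : L) :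
    v (σ x : L) = v (x : Kbar) := by
  have hmono : ∀ x y : L, v (σ x : L) ≤ v (σ y : L) ↔ v (x : Kbar) ≤ v (y : Kbar) := by
    intro x y
    have h := hens.map_le_map_iff (σ.liftNormal Kbar) x y
    have hc : ∀ t : L, σ.liftNormal Kbar (t : Kbar) = (σ t : L) :=
      fun t => σ.liftNormal_commutes Kbar t
    rwa [hc, hc] at h
  -- Since `σ` preserves the order on values, the values of `x, σ x, σ² x, …` form a monotone chain;
  -- it returns to its start because `σ` has finite order, so it is constant.
  obtain ⟨n, hn, hpow⟩ := isOfFinOrder_iff_pow_eq_one.mp (isOfFinOrder_of_finite σ)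
  obtain ⟨m, rfl⟩ := Nat.exists_eq_succ_of_ne_zero hn.ne'
  have hlast : σ ((σ ^ m) x) = x := by
    rw [← AlgEquiv.mul_apply, ← pow_succ', hpow, AlgEquiv.one_apply]
  have hsucc : ∀ k, σ ((σ ^ k) x) = (σ ^ (k + 1)) x := fun k => by
    rw [← AlgEquiv.mul_apply, ← pow_succ']
  rcases le_total (v (σ x : L)) (v (x : Kbar)) with h | h
  · have hk : ∀ k, v ((σ ^ k) x : L) ≤ v (x : Kbar) := by
      intro k
      induction k with
      | zero => simp
      | succ k ih =>
        rw [← hsucc]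
        exact ((hmono _ _).mpr ih).trans h
    refine h.antisymm ?_
    have := (hmono _ _).mpr (hk m)
    rwa [hlast] at this
  · have hk : ∀ k, v (x : Kbar) ≤ v ((σ ^ k) x : L) := by
      intro k
      induction k with
      | zero => simp
      | succ k ih =>
        rw [← hsucc]
        exact h.trans ((hmono _ _).mpr ih)
    refine le_antisymm ?_ h
    have := (hmono _ _).mpr (hk m)
    rwa [hlast] at this

/-! ### Pure elements and pseudo-convergent sequences -/

theorem exists_algebraMap_eq_of_deg_eq_one [Algebra.IsAlgebraic K Kbar] {y : Kbar}
    (hy : deg K y = 1) : ∃ c : K, algebraMap K Kbar c = y :=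
  minpoly.mem_range_of_degree_eq_one K y
    ((degree_eq_iff_natDegree_eq_of_pos one_pos).mpr hy)

/-- A pure element is approximated by elements of `K` at least as well as by any other element of
smaller degree. -/
theorem IsPure.exists_le [Algebra.IsAlgebraic K Kbar] {a : Kbar} (hpure : IsPure K v a) {b : Kbar}
    (hb : deg K b < deg K a) : ∃ c : K, v (a - algebraMap K Kbar c) ≤ v (a - b) := by
  have hmem : (1 : ℕ) ∈ {n | ∃ A d, IsOkutsuSequence K v a n A d} := by
    -- `sInf ∅ = 0`, so depth `1` ensures that an Okutsu sequence exists.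
    have hne : {n | ∃ A d, IsOkutsuSequence K v a n A d}.Nonempty :=
      Nat.nonempty_of_pos_sInf (by
        change 0 < depth K v a
        rw [show depth K v a = 1 from hpure]
        exact one_pos)
    have h := Nat.sInf_mem hne
    rwa [show sInf {n | ∃ A d, IsOkutsuSequence K v a n A d} = 1 from hpure] at h
  obtain ⟨A, d, hA⟩ := hmem
  have hd : deg K a = d 0 := (hA.commonDegree 0 zero_le_one).2 a (by simp [hA.zero])
  obtain ⟨y, hy, hle⟩ := hA.exists_closer 0 one_pos b (hd ▸ hb)
  obtain ⟨c, rfl⟩ := exists_algebraMap_eq_of_deg_eq_one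
    (((hA.commonDegree 1 le_rfl).2 y hy).trans hA.degree_last)
  exact ⟨c, hle⟩

section Sequence

variable {l : Ordinal.{u}} {z : Ordinal.{u} → K} {a : Kbar}

/-- `v (a - z μ) < v (z ν - z μ)`, and the right side is at most the larger of `v (a - z μ)` and `v
(a - z ν)`, which must be the latter. -/
theorem IsPseudoConvergent.map_sub_lt_map_sub (hz : IsPseudoConvergent v l z)
    (hlim : IsPseudoLimit v l z a) {ν μ : Ordinal.{u}} (hνμ : ν < μ) (hμ : μ < l) :
    v (a - algebraMap K Kbar (z μ)) < v (a - algebraMap K Kbar (z ν)) := by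
  have h := hz.2 ν μ (Order.succ μ) hνμ (Order.lt_succ μ) (hz.1.succ_lt hμ)
  rw [← hlim μ hμ, map_sub (algebraMap K Kbar), show algebraMap K Kbar (z ν) - algebraMap K Kbar (z μ) =
    (a - algebraMap K Kbar (z μ)) - (a - algebraMap K Kbar (z ν)) by ring] at h
  exact (lt_max_iff.mp (h.trans_le (v.map_sub _ _))).resolve_left (lt_irrefl _)

/-- If the sequence has no limit in `K`, then its members approximate its limit `a` better than
any given element of `K`. -/
theorem IsPseudoConvergent.exists_map_sub_lt (hz : IsPseudoConvergent v l z)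
    (hlim : IsPseudoLimit v l z a)
    (hnolim : ∀ x : K, ¬ IsPseudoLimit v l z (algebraMap K Kbar x)) (c : K) :
    ∃ ν < l, v (a - algebraMap K Kbar (z ν)) < v (a - algebraMap K Kbar c) := by
  -- Otherwise `c` is at least as close to `a` as every `z (succ ν)`, hence strictly closer than `z
  -- ν`. Then `v (c - z ν) = v (a - z ν)`, and `c` would be a limit in `K`.
  by_contra! hcon
  refine hnolim c fun ν hν => ?_
  have hlt := (hcon _ (hz.1.succ_lt hν)).trans_lt
    (hz.map_sub_lt_map_sub hlim (Order.lt_succ ν) (hz.1.succ_lt hν))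
  rw [← hlim ν hν, show algebraMap K Kbar c - algebraMap K Kbar (z ν) =
    (a - algebraMap K Kbar (z ν)) - (a - algebraMap K Kbar c) by ring]
  exact v.map_sub_eq_of_lt_left hlt

/-- Each `b` is dominated by some `c` in `K`, and `c` by some member of the sequence; for finitely
many `b` the largest index serves. -/
theorem exists_forall_map_sub_le [Algebra.IsAlgebraic K Kbar] (hpure : IsPure K v a)
    (hz : IsPseudoConvergent v l z) (hlim : IsPseudoLimit v l z a)
    (hnolim : ∀ x : K, ¬ IsPseudoLimit v l z (algebraMap K Kbar x)) (s : Multiset Kbar)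
    (hs : ∀ b ∈ s, deg K b < deg K a) :
    ∃ ν < l, ∀ b ∈ s, v (a - algebraMap K Kbar (z ν)) ≤ v (a - b) := by
  induction s using Multiset.induction_on with
  | empty => exact ⟨0, hz.1.bot_lt, by simp⟩
  | cons b s ih =>
    obtain ⟨ν, hν, hνs⟩ := ih fun x hx => hs x (Multiset.mem_cons_of_mem hx)
    obtain ⟨c, hc⟩ := hpure.exists_le (hs b (Multiset.mem_cons_self b s))
    obtain ⟨μ, hμ, hμc⟩ := hz.exists_map_sub_lt hlim hnolim c
    have hanti : ∀ {ν μ : Ordinal.{u}}, ν ≤ μ → μ < l →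
        v (a - algebraMap K Kbar (z μ)) ≤ v (a - algebraMap K Kbar (z ν)) := by
      intro ν μ hνμ hμ
      rcases hνμ.eq_or_lt with rfl | h
      · exact le_rfl
      · exact (hz.map_sub_lt_map_sub hlim h hμ).le
    refine ⟨max ν μ, max_lt hν hμ, fun x hx => ?_⟩
    rcases Multiset.mem_cons.mp hx with rfl | hx
    · exact (hanti (le_max_right ν μ) (max_lt hν hμ)).trans (hμc.le.trans hc)
    · exact (hanti (le_max_left ν μ) (max_lt hν hμ)).trans (hνs x hx)

/-- For `f` of degree less than `deg a`, the relative error of `f` between `a` and an element `a'`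
close to `a` is bounded by `v (a' - a) / v (a - z ν)` for some `ν`. -/
theorem exists_map_aeval_sub_aeval_mul_le [IsAlgClosed Kbar] [Algebra.IsAlgebraic K Kbar]
    (hpure : IsPure K v a) (hz : IsPseudoConvergent v l z) (hlim : IsPseudoLimit v l z a)
    (hnolim : ∀ x : K, ¬ IsPseudoLimit v l z (algebraMap K Kbar x)) {a' : Kbar}
    (ha' : ∀ ν < l, v (a' - a) ≤ v (a - algebraMap K Kbar (z ν))) {f : K[X]} (hf0 : f ≠ 0)
    (hf : f.natDegree < deg K a) :
    ∃ ν < l, v (aeval a' f - aeval a f) * v (a - algebraMap K Kbar (z ν)) ≤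
      v (a' - a) * v (aeval a f) := by
  set s := f.aroots Kbar
  obtain ⟨ν, hν, hs⟩ := exists_forall_map_sub_le hpure hz hlim hnolim s fun b hb =>
    (natDegree_le_of_dvd (minpoly.dvd K b (mem_aroots.mp hb).2) hf0).trans_lt hf
  refine ⟨ν, hν, ?_⟩
  have hprod : ∀ x : Kbar, aeval x f =
      algebraMap K Kbar f.leadingCoeff * (s.map (x - ·)).prod :=
    fun x => Splits.aeval_eq_prod_aroots (IsAlgClosed.splits _) x
  rw [hprod, hprod, ← mul_sub, map_mul, map_mul, mul_assoc, mul_left_comm (v (a' - a))]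
  exact mul_le_mul' le_rfl (map_prod_sub_sub_prod_sub_mul_le v (ha' ν hν) s hs)

end Sequence

/-! ### Comparison of ideals through values -/

theorem mem_valRing_iff {Ω : IntermediateField K Kbar} {x : Ω} :
    x ∈ valRing v Ω ↔ v (x : Kbar) ≤ 1 :=
  Iff.rfl

/-- A set of integral elements generates a larger ideal than another one, if each element of the
latter is bounded in value by some element of the former. -/
theorem idealGenBy_le_idealGenBy {Ω : IntermediateField K Kbar} {S T : Set Ω}
    (hT : T ⊆ (valRing v Ω : Set Ω))
    (h : ∀ x ∈ S, ∃ y ∈ T, v (x : Kbar) ≤ v (y : Kbar)) :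
    idealGenBy v Ω S ≤ idealGenBy v Ω T := by
  refine Ideal.span_le.mpr fun x hx => ?_
  obtain ⟨y, hy, hxy⟩ := h x hx
  let y' : valRing v Ω := ⟨y, hT hy⟩
  have hdvd : y' ∣ x := by
    by_cases hy0 : y = 0
    · have hx0 : (x : Ω) = 0 := by
        have : v ((x : Ω) : Kbar) = 0 := by simpa [hy0] using hxy
        simpa using this
      have : x = 0 := Subtype.ext hx0
      rw [this]
      exact dvd_zero _
    · have hvy : 0 < v (y : Kbar) := zero_lt_iff.mpr ((Valuation.ne_zero_iff v).mpr (by simpa))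
      refine ⟨⟨(x : Ω) / y, ?_⟩, Subtype.ext ?_⟩
      · rw [mem_valRing_iff, IntermediateField.coe_div, map_div₀]
        exact (div_le_one₀ hvy).mpr hxy
      · exact (mul_div_cancel₀ (x : Ω) hy0).symm
  exact Ideal.mem_of_dvd _ hdvd (Ideal.subset_span hy)

end Purity

/-- `K(a) | K` is a Galois defect extension of henselian valued fields, `a` is pure over `K`, and
`(z ν)_{ν < l}` is a pseudo-convergent sequence in `K` with limit `a` and without a limit in `K`.
For each subgroup `H` of the Galois group, the defining generators of `I_H` and the elements
`(σ a - a) / (a - z ν)` lie in the valuation ring of `K(a)`, and the latter generate `I_H`. -/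
theorem theorem8p15 {K Kbar : Type u} [Field K] [Field Kbar] [Algebra K Kbar]
    [IsAlgClosure K Kbar] {Γ₀ : Type w} [LinearOrderedCommGroupWithZero Γ₀]
    (v : Valuation Kbar Γ₀) (hens : Purity.IsHenselian K v)
    (a : Kbar) (hgal : IsGalois K K⟮a⟯) (hdefect : 1 < Purity.defect v K⟮a⟯)
    (hpure : Purity.IsPure K v a)
    (l : Ordinal.{u}) (z : Ordinal.{u} → K) (hz : Purity.IsPseudoConvergent v l z)
    (hlim : Purity.IsPseudoLimit v l z a)
    (hnolim : ∀ x : K, ¬ Purity.IsPseudoLimit v l z (algebraMap K Kbar x))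
    (H : Subgroup (K⟮a⟯ ≃ₐ[K] K⟮a⟯)) :
    Purity.ramificationGens H ⊆ (Purity.valRing v K⟮a⟯ : Set K⟮a⟯) ∧
      Purity.quotientGens H l z ⊆ (Purity.valRing v K⟮a⟯ : Set K⟮a⟯) ∧
      Purity.ramificationIdeal v H =
        Purity.idealGenBy v K⟮a⟯ (Purity.quotientGens H l z) := by
  have hac : IsAlgClosed Kbar := IsAlgClosure.isAlgClosed K
  have halg : Algebra.IsAlgebraic K Kbar := IsAlgClosure.isAlgebraic
  have hnormal : Normal K Kbar := IsAlgClosure.normal K Kbar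
  have hint : IsIntegral K a := Algebra.IsIntegral.isIntegral a
  have hfin : FiniteDimensional K K⟮a⟯ := IntermediateField.adjoin.finiteDimensional hint
  set α := IntermediateField.AdjoinSimple.gen K a with hα
  have hinv : ∀ (σ : K⟮a⟯ ≃ₐ[K] K⟮a⟯) (x : K⟮a⟯), v (σ x : K⟮a⟯) = v (x : Kbar) :=
    hens.map_algEquiv
  have hram : Purity.ramificationGens H ⊆ (Purity.valRing v K⟮a⟯ : Set K⟮a⟯) := by
    rintro _ ⟨σ, -, x, hx, rfl⟩
    refine sub_mem ?_ (one_mem _)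
    rw [Purity.mem_valRing_iff, IntermediateField.coe_div, map_div₀, hinv]
    exact div_self_le_one _
  have hpos : ∀ ν < l, a - algebraMap K Kbar (z ν) ≠ 0 := by
    intro ν hν h0
    have hlt := hz.map_sub_lt_map_sub hlim (Order.lt_succ ν) (hz.1.succ_lt hν)
    rw [h0, map_zero] at hlt
    exact not_lt_zero hlt
  have hquot : Purity.quotientGens H l z ⊆ Purity.ramificationGens H := by
    rintro _ ⟨σ, hσ, ν, hν, rfl⟩
    have hne : α - algebraMap K K⟮a⟯ (z ν) ≠ 0 := fun h => hpos ν hν (by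
      have := congrArg (algebraMap K⟮a⟯ Kbar) h
      rw [map_sub, map_zero, ← IsScalarTower.algebraMap_apply] at this
      exact this)
    refine ⟨σ, hσ, _, hne, ?_⟩
    rw [map_sub, AlgEquiv.commutes, div_sub_one hne, sub_sub_sub_cancel_right]
  have hquotRing := hquot.trans hram
  have hcoe : ∀ (σ : K⟮a⟯ ≃ₐ[K] K⟮a⟯) (ν : Ordinal.{u}),
      (((σ α - α) / (α - algebraMap K K⟮a⟯ (z ν)) : K⟮a⟯) : Kbar) =
        ((σ α : K⟮a⟯) - a) / (a - algebraMap K Kbar (z ν)) := fun _ _ => rfl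
  refine ⟨hram, hquotRing, le_antisymm (Purity.idealGenBy_le_idealGenBy hquotRing ?_)
    (Purity.idealGenBy_le_idealGenBy hram fun x hx => ⟨x, hquot hx, le_rfl⟩)⟩
  rintro _ ⟨σ, hσ, x, hx, rfl⟩
  -- Integrality of the quotients is precisely the closeness of `σ a` to `a` that the perturbation
  -- estimate requires.
  have hclose : ∀ ν < l, v ((σ α : K⟮a⟯) - a) ≤ v (a - algebraMap K Kbar (z ν)) := by
    intro ν hν
    have h := Purity.mem_valRing_iff.mp (hquotRing ⟨σ, hσ, ν, hν, rfl⟩)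
    rw [← hα, hcoe, map_div₀] at h
    exact (div_le_one₀ (zero_lt_iff.mpr ((Valuation.ne_zero_iff v).mpr (hpos ν hν)))).mp h
  -- The power basis of `K(a)` supplies a representative `f` of degree below `deg a`, the range in
  -- which purity applies to its roots.
  obtain ⟨f, hfdeg, hfx⟩ := (IntermediateField.adjoin.powerBasis hint).exists_eq_aeval x
  rw [IntermediateField.adjoin.powerBasis_gen, ← hα] at hfx
  rw [IntermediateField.adjoin.powerBasis_dim] at hfdeg
  have hf0 : f ≠ 0 := by
    rintro rfl
    exact hx (by simpa using hfx)
  obtain ⟨ν, hν, hle⟩ := Purity.exists_map_aeval_sub_aeval_mul_le hpure hz hlim hnolim hclose hf0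
    hfdeg
  have hxa : (x : Kbar) = Polynomial.aeval a f := by
    rw [hfx]
    exact (Polynomial.aeval_algebraMap_apply Kbar α f).symm
  have hσx : ((σ x : K⟮a⟯) : Kbar) = Polynomial.aeval ((σ α : K⟮a⟯) : Kbar) f := by
    rw [hfx, ← Polynomial.aeval_algHom_apply]
    exact (Polynomial.aeval_algebraMap_apply Kbar (σ α) f).symm
  refine ⟨_, ⟨σ, hσ, ν, hν, rfl⟩, ?_⟩
  have hxK : (x : Kbar) ≠ 0 := by simpa using hx
  rw [← hα, hcoe, div_sub_one hx, IntermediateField.coe_div, AddSubgroupClass.coe_sub, map_div₀,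
    map_div₀, div_le_div_iff₀ (zero_lt_iff.mpr ((Valuation.ne_zero_iff v).mpr hxK))
      (zero_lt_iff.mpr ((Valuation.ne_zero_iff v).mpr (hpos ν hν))), hσx, hxa]
  exact hle
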